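/- **Setting.** Let $\mathbb K\in\{\mathbb R,\mathbb C\}$, let $X$ be a first countable topological space (for example a metrizable space), $Y$ a locally compact Hausdorff space and $\mu$ a $\mathbb K$-valued Radon measure on $Y$, i.e. a linear form on $C_c(Y,\mathbb K)$ that is continuous for the uniform norm on the functions supported in any given compact set. Let $|\mu|$ be its total variation, and let $\int^{*}$ and $\int^{\bullet}$ be the upper and the essential upper integral (in the sense of Bourbaki). For a Hausdorff locally convex space $F$ over $\mathbb K$, $\mathfrak L_1(Y,F,\mu)$ is the space of scalarly essentially $\mu$-integrable maps $f:Y\to F$ whose integral $\int f\,d\mu$ belongs to $F$, and $\mathrm{Meas}(Y,F,\mu)$ is the space of $\mu$-measurable maps $Y\to F$. Let $\mathfrak V=\langle\langle\mathfrak E,\tau\rangle,\pi,X,\{\nu_j\}_{j\in J}\rangle$ be a bundle of $\Omega$-spaces over $X$, that is: every fibre $\mathfrak E_x=\pi^{-1}(x)$ is a Hausdorff locally convex space over $\mathbb K$ whose topology is given by the restrictions to it of the directed family of fibrewise seminorms $\nu_j:\mathfrak E\to\mathbb R$; $\pi$ is continuous; addition $\mathfrak E\times_X\mathfrak E\to\mathfrak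 E$ and scalar multiplication $\mathbb K\times\mathfrak E\to\mathfrak E$ are continuous; and the tubes $\{b\in\mathfrak E:\pi(b)\in U,\ \nu_j(b-\sigma(\pi(b)))<\varepsilon\}$ ($U\subseteq X$ open, $\sigma$ a bounded continuous selection on $U$, $j\in J$, $\varepsilon>0$) form a base of the topology $\tau$, every $b\in\mathfrak E$ lying in such a tube for each prescribed $j$ and $\varepsilon$. A selection $\sigma$ on a set $U$ is bounded if $\sup_{x\in U}\nu_j(\sigma(x))<\infty$ for all $j$; write $\prod^{b}_{x\in X}\mathfrak E_x$ for the set of bounded selections on $X$. Let $\Gamma(\pi)$ be the set of bounded continuous selections on $X$ (global sections), $\Gamma^{x}(\pi)$ the set of bounded selections on $X$ that are continuous at $x$, and $\Gamma^{x}_{\diamond}(\pi)=\{F\in\Gamma^{x}(\pi):\exists\,\eta\in\Gamma(\pi),\ F(x)=\eta(x)\}$; use the same notation for other bundles. Let $\mathfrak Z=\langle\langle\mathfrak T,\gamma\rangle,\zeta,X,\mathfrak K\rangle$ be a second bundle of $\Omega$-spaces over $X$ whose fibres $\mathfrak T_x$ are linear subspaces of $\mathfrak E_x^{Y}$ with the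 topology of pointwise convergence. For $\mathcal A\subseteq\prod^{b}_{x\in X}\mathfrak T_x$ put $$[\mathcal A]_{ui}=\Big\{H\in\mathcal A:\ \int^{\bullet}_{Y}\sup_{x\in X}\nu_j(H(x)(s))\,d|\mu|(s)<\infty\ \text{ for all } j\in J\Big\},$$ and for a selection $H$ with $H(x)\in\mathfrak L_1(Y,\mathfrak E_x,\mu)$ for all $x$ put $\overset{\mu}{\blacklozenge}(H)(x)=\int H(x)(s)\,d\mu(s)\in\mathfrak E_x$. The pair $\langle\mathfrak V,\mathfrak Z\rangle$ is called *$\mu$-related* if 1. for all $x\in X$, $\mathfrak T_x\subseteq\mathrm{Meas}(Y,\mathfrak E_x,\mu)\cap\mathfrak L_1(Y,\mathfrak E_x,\mu)$, and the seminorms of $\mathfrak Z$ are $f\mapsto\sup_{(s,j)\in O}\nu_j(f(s))$ on every $\mathfrak T_x$, indexed by the finite sets $O\subseteq Y\times J$; 2. $\Gamma(\zeta)\subseteq\big[\prod^{b}_{x\in X}\mathfrak T_x\big]_{ui}$; 3. $\overset{\mu}{\blacklozenge}(\Gamma(\zeta))\subseteq\Gamma(\pi)$. **Theorem (GLT).**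 If $\langle\mathfrak V,\mathfrak Z\rangle$ are $\mu$-related, then for all $x\in X$ $$\overset{\mu}{\blacklozenge}\big([\Gamma^{x}_{\diamond}(\zeta)]_{ui}\big)\subseteq\Gamma^{x}_{\diamond}(\pi).$$ -/

import Mathlib

open Topology Filter Set
open scoped ENNReal NNReal CompactlySupported

noncomputable section

/-! ### Radon measures and the essential integral

`Y` is a locally compact Hausdorff space and `𝕂` is `ℝ` or `ℂ`. -/

/-- A `𝕂`-valued Radon measure on `Y`: a linear form on the continuous `𝕂`-valued functions with
compact support whose restriction to the functions supported in a given compact set is continuous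
for the uniform norm. -/
structure RadonMeasure (𝕂 Y : Type*) [RCLike 𝕂] [TopologicalSpace Y] where
  toLinearMap : C_c(Y, 𝕂) →ₗ[𝕂] 𝕂
  bound : ∀ K : Set Y, IsCompact K → ∃ C : ℝ, ∀ f : C_c(Y, 𝕂), tsupport f ⊆ K →
    ‖toLinearMap f‖ ≤ C * ⨆ y, ‖f y‖

namespace RadonMeasure

variable {𝕂 Y : Type*} [RCLike 𝕂] [TopologicalSpace Y] (μ : RadonMeasure 𝕂 Y)

/-- The total variation `|μ|` on a nonnegative `f`: the supremum of `|μ(g)|` over `|g| ≤ f`. -/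
def variation (f : C_c(Y, ℝ≥0)) : ℝ≥0∞ :=
  ⨆ (g : C_c(Y, 𝕂)) (_ : ∀ y, ‖g y‖₊ ≤ f y), ‖μ.toLinearMap g‖ₑ

/-- `|μ|^*(h)` for a lower semicontinuous `h ≥ 0`: the supremum of `|μ|(f)` over the continuous
`f ≥ 0` with compact support such that `f ≤ h`. -/
def lscIntegral (h : Y → ℝ≥0∞) : ℝ≥0∞ :=
  ⨆ (f : C_c(Y, ℝ≥0)) (_ : ∀ y, (f y : ℝ≥0∞) ≤ h y), μ.variation f

/-- The upper integral `∫^* h d|μ|` of an arbitrary `h ≥ 0`. -/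
def upperIntegral (h : Y → ℝ≥0∞) : ℝ≥0∞ :=
  ⨅ (k : Y → ℝ≥0∞) (_ : LowerSemicontinuous k) (_ : ∀ y, h y ≤ k y), μ.lscIntegral k

/-- The essential upper integral `∫^• h d|μ|` of an arbitrary `h ≥ 0`. -/
def essUpperIntegral (h : Y → ℝ≥0∞) : ℝ≥0∞ :=
  ⨆ (K : Set Y) (_ : IsCompact K), μ.upperIntegral (K.indicator h)

/-- `μ`-measurable maps into a topological space: on every compact set the map is continuous off
a set of arbitrarily small measure whose complement is compact. -/
def IsMeasurableMap {F : Type*} [TopologicalSpace F] (f : Y → F) : Prop :=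
  ∀ K : Set Y, IsCompact K → ∀ ε : ℝ≥0∞, 0 < ε →
    ∃ K₁ : Set Y, IsCompact K₁ ∧ K₁ ⊆ K ∧ ContinuousOn f K₁ ∧
      μ.upperIntegral ((K \ K₁).indicator 1) ≤ ε

/-- The scalar function `f` is essentially `μ`-integrable with integral `z`: the essentially
integrable functions are the closure of the continuous functions with compact support for the
seminorm `f ↦ ∫^• |f| d|μ|`, and the integral is the continuous extension of `μ`. -/
def HasScalarIntegral (f : Y → 𝕂) (z : 𝕂) : Prop :=
  ∀ ε : ℝ≥0∞, 0 < ε → ∃ g : C_c(Y, 𝕂),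
    μ.essUpperIntegral (fun y => ‖f y - g y‖ₑ) < ε ∧ ‖μ.toLinearMap g - z‖ₑ < ε

variable {F : Type*} [AddCommGroup F] [Module 𝕂 F] [TopologicalSpace F]

/-- The map `f : Y → F` is scalarly essentially `μ`-integrable and its integral is the vector
`e` of `F`. -/
def HasIntegral (f : Y → F) (e : F) : Prop :=
  ∀ φ : F →L[𝕂] 𝕂, μ.HasScalarIntegral (fun y => φ (f y)) (φ e)

/-- The space `𝔏₁(Y, F, μ)`: scalarly essentially `μ`-integrable maps with integral in `F`. -/
def MemL1 (f : Y → F) : Prop := ∃ e : F, μ.HasIntegral f e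

open Classical in
/-- The integral `∫ f dμ` of a map in `𝔏₁(Y, F, μ)` (and `0` for all other maps). -/
def integral (f : Y → F) : F := if h : μ.MemL1 f then h.choose else 0

end RadonMeasure

/-! ### Bundles of Ω-spaces -/

/-- The total space of a family of fibres. -/
structure TotalFibres {X : Type*} (E : X → Type*) where
  base : X
  vec : E base

/-- A bundle of Ω-spaces `⟨⟨𝔈, τ⟩, π, X, 𝔫⟩` with fibres `E x` and `𝔫 = {ν j | j ∈ J}`. -/
structure OmegaBundle (𝕂 X J : Type*) [RCLike 𝕂] [TopologicalSpace X] (E : X → Type*)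
    [∀ x, AddCommGroup (E x)] [∀ x, Module 𝕂 (E x)] [∀ x, TopologicalSpace (E x)] where
  /-- the seminorms, fibre by fibre -/
  ν : J → ∀ x, Seminorm 𝕂 (E x)
  /-- the family of seminorms on the total space is directed -/
  directed : ∀ j₁ j₂, ∃ j, ∀ x, ν j₁ x ≤ ν j x ∧ ν j₂ x ≤ ν j x
  /-- each fibre is a Hausdorff locally convex space, with the topology given by the seminorms -/
  withSeminorms : ∀ x, WithSeminorms (fun j => ν j x)
  t2 : ∀ x, T2Space (E x)
  /-- the topology of the total space -/
  [top : TopologicalSpace (TotalFibres E)]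
  continuous_proj : Continuous (TotalFibres.base : TotalFibres E → X)
  /-- addition is continuous on the fibred product of the total space with itself -/
  continuous_add : Continuous[TopologicalSpace.induced
      (fun q : (Σ x, E x × E x) => ((⟨q.1, q.2.1⟩, ⟨q.1, q.2.2⟩) : TotalFibres E × TotalFibres E))
      inferInstance, top]
    (fun q : (Σ x, E x × E x) => (⟨q.1, q.2.1 + q.2.2⟩ : TotalFibres E))
  continuous_smul : Continuous
    (fun q : 𝕂 × TotalFibres E => (⟨q.2.base, q.1 • q.2.vec⟩ : TotalFibres E))
  /-- tubes around bounded continuous local selections are open -/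
  isOpen_tube : ∀ (U : Set X) (σ : ∀ x, E x), IsOpen U →
    ContinuousOn (fun x => (⟨x, σ x⟩ : TotalFibres E)) U →
    (∀ j, BddAbove ((fun x => ν j x (σ x)) '' U)) →
    ∀ (j : J) (ε : ℝ), 0 < ε →
      IsOpen {b : TotalFibres E | b.base ∈ U ∧ ν j b.base (b.vec - σ b.base) < ε}
  /-- every point is approximated by bounded continuous local selections -/
  exists_section : ∀ (b : TotalFibres E) (j : J) (ε : ℝ), 0 < ε →
    ∃ (U : Set X) (σ : ∀ x, E x), IsOpen U ∧ b.base ∈ U ∧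
      ContinuousOn (fun x => (⟨x, σ x⟩ : TotalFibres E)) U ∧
      (∀ i, BddAbove ((fun x => ν i x (σ x)) '' U)) ∧ ν j b.base (b.vec - σ b.base) < ε
  /-- the tubes form a base of the topology -/
  exists_tube : ∀ (b : TotalFibres E), ∀ W ∈ 𝓝 b,
    ∃ (U : Set X) (σ : ∀ x, E x) (j : J) (ε : ℝ), IsOpen U ∧ b.base ∈ U ∧
      ContinuousOn (fun x => (⟨x, σ x⟩ : TotalFibres E)) U ∧
      (∀ i, BddAbove ((fun x => ν i x (σ x)) '' U)) ∧
      0 < ε ∧ ν j b.base (b.vec - σ b.base) < ε ∧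
      {c : TotalFibres E | c.base ∈ U ∧ ν j c.base (c.vec - σ c.base) < ε} ⊆ W

namespace OmegaBundle

variable {𝕂 X J : Type*} [RCLike 𝕂] [TopologicalSpace X] {E : X → Type*}
  [∀ x, AddCommGroup (E x)] [∀ x, Module 𝕂 (E x)] [∀ x, TopologicalSpace (E x)]
  (V : OmegaBundle 𝕂 X J E)

/-- The bounded selections `∏ᵇ E x`. -/
def boundedSelections : Set (∀ x, E x) :=
  {σ | ∀ j, BddAbove (range fun x => V.ν j x (σ x))}

/-- `Γˣ(π)`: the bounded selections that are continuous at `x`. -/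
def sectionsAt (x : X) : Set (∀ x, E x) :=
  {σ ∈ V.boundedSelections |
    letI := V.top; ContinuousAt (fun z => (⟨z, σ z⟩ : TotalFibres E)) x}

/-- `Γ(π)`: the global sections, that is, the bounded continuous selections. -/
def sections : Set (∀ x, E x) :=
  {σ ∈ V.boundedSelections |
    letI := V.top; Continuous (fun z => (⟨z, σ z⟩ : TotalFibres E))}

/-- `Γˣ_⋄(π)`: the elements of `Γˣ(π)` that agree at `x` with some global section. -/
def diamondSectionsAt (x : X) : Set (∀ x, E x) :=
  {σ ∈ V.sectionsAt x | ∃ η ∈ V.sections, σ x = η x}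

end OmegaBundle

/-! ### `μ`-related bundles -/

section Related

variable {𝕂 X Y J : Type*} [RCLike 𝕂] [TopologicalSpace X] [TopologicalSpace Y] {E : X → Type*}
  [∀ x, AddCommGroup (E x)] [∀ x, Module 𝕂 (E x)] [∀ x, TopologicalSpace (E x)]
  {T : ∀ x, Submodule 𝕂 (Y → E x)}

/-- The map `◆^μ`, integration over `Y` in every fibre. -/
def integrateSelection (μ : RadonMeasure 𝕂 Y) (H : ∀ x, T x) : ∀ x, E x :=
  fun x => μ.integral (H x : Y → E x)

/-- `[𝒜]_ui`: the members `H` of `𝒜` such that `∫^• sup_x ν_j(H(x)(s)) d|μ|(s) < ∞` for every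
`j`. -/
def uniformlyIntegrable (μ : RadonMeasure 𝕂 Y) (V : OmegaBundle 𝕂 X J E) (A : Set (∀ x, T x)) :
    Set (∀ x, T x) :=
  {H ∈ A | ∀ j, μ.essUpperIntegral
    (fun s => ⨆ x, ENNReal.ofReal (V.ν j x ((H x : Y → E x) s))) < ∞}

/-- `⟨𝔙, ℨ⟩` are `μ`-related. The fibre `T x` of `ℨ` carries the topology of pointwise
convergence (it is a subspace of `Y → E x`). -/
structure MuRelated (μ : RadonMeasure 𝕂 Y) (V : OmegaBundle 𝕂 X J E)
    (Z : OmegaBundle 𝕂 X (Finset (Y × J)) (fun x => T x)) : Prop where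
  measurable : ∀ x, ∀ f ∈ T x, μ.IsMeasurableMap f
  memL1 : ∀ x, ∀ f ∈ T x, μ.MemL1 f
  /-- the seminorms of `ℨ` are the finite suprema of the `f ↦ ν_j(f(s))` -/
  seminorm_eq : ∀ (O : Finset (Y × J)) (x : X), Z.ν O x =
    O.sup fun p => (V.ν p.2 x).comp ((LinearMap.proj p.1).comp (T x).subtype)
  sections_ui : Z.sections ⊆ uniformlyIntegrable μ V Z.boundedSelections
  integrate_sections : integrateSelection μ '' Z.sections ⊆ V.sections

end Related

end

/-! Let `H` agree at `x` with the global section `η` of `Z`. The integral of `η` is a section of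
`V`, so by the tube description of the topology it is enough that `ν j` of the difference of the
integrals of `H z` and `η z` tends to `0` as `z → x`. By Hahn–Banach (`HasIntegral.seminorm_le`)
this quantity is at most the essential upper integral of `s ↦ ν j (H z s - η z s)`. For each fixed
`s` the integrand tends to `0`, because evaluation at `s` followed by `ν j` is one of the seminorms
of `Z`; it is dominated by the sum of the two suprema from uniform integrability. First countability
reduces the limit to sequences, and dominated convergence concludes.

The analytic core is dominated convergence for the essential upper integral
(`tendsto_essUpperIntegral_zero`), where the dominating function need not be measurable. It is
transferred from Lebesgue theory: `|μ|` is additive, so it is represented by a regular Borel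
measure, and the upper integrals are compared with integrals against that measure. -/

noncomputable section

/-! ### The total variation as a positive linear functional. -/

namespace RadonMeasure

open MeasureTheory

variable {𝕂 Y : Type*} [RCLike 𝕂] [TopologicalSpace Y] (μ : RadonMeasure 𝕂 Y)

theorem enorm_le_variation {g : C_c(Y, 𝕂)} {f : C_c(Y, ℝ≥0)} (h : ∀ y, ‖g y‖₊ ≤ f y) :
    ‖μ.toLinearMap g‖ₑ ≤ μ.variation f :=
  le_iSup₂ (f := fun (g : C_c(Y, 𝕂)) (_ : ∀ y, ‖g y‖₊ ≤ f y) => ‖μ.toLinearMap g‖ₑ) g h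

theorem variation_ne_top (f : C_c(Y, ℝ≥0)) : μ.variation f ≠ ∞ := by
  obtain ⟨C, hC⟩ := μ.bound (tsupport f) f.hasCompactSupport
  obtain ⟨B, hB⟩ := f.hasCompactSupport.exists_bound_of_continuousOn
    (NNReal.continuous_coe.comp f.continuous).continuousOn
  have hB0 : ∀ y, (f y : ℝ) ≤ max B 0 := fun y => by
    by_cases hy : y ∈ tsupport f
    · exact le_max_of_le_left ((le_abs_self _).trans (hB y hy))
    · simp [image_eq_zero_of_notMem_tsupport hy]
  -- Neither `C` nor `B` is known to be nonnegative, hence `|C|` and `max B 0`.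
  refine ne_top_of_le_ne_top (b := ENNReal.ofReal (|C| * max B 0)) ENNReal.ofReal_ne_top ?_
  refine iSup₂_le fun g hg => ?_
  have hsub : tsupport g ⊆ tsupport f := by
    refine closure_mono fun y hy => ?_
    contrapose! hy
    have := hg y
    simp only [Function.mem_support, not_not] at hy ⊢
    simpa [hy] using this
  have hg' : ∀ y, ‖g y‖ ≤ max B 0 := fun y => le_trans (by exact_mod_cast hg y) (hB0 y)
  rw [← ofReal_norm]
  refine ENNReal.ofReal_le_ofReal ((hC g hsub).trans ?_)
  have h1 : ⨆ y, ‖g y‖ ≤ max B 0 := Real.iSup_le hg' (le_max_right _ _)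
  have h0 : 0 ≤ ⨆ y, ‖g y‖ := Real.iSup_nonneg fun y => norm_nonneg _
  gcongr
  exact le_abs_self C

theorem smul_variation_le (c : ℝ≥0) (f : C_c(Y, ℝ≥0)) :
    c * μ.variation f ≤ μ.variation (c • f) := by
  rw [variation, ENNReal.mul_iSup]
  refine iSup_le fun g => ?_
  rw [ENNReal.mul_iSup]
  refine iSup_le fun hg => ?_
  have h := μ.enorm_le_variation (g := ((c : ℝ) : 𝕂) • g) (f := c • f) fun y => by
    simpa [nnnorm_smul] using mul_le_mul_right (hg y) c
  refine le_trans (le_of_eq ?_) h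
  rw [map_smul, enorm_smul]
  congr 1
  simp [← ofReal_norm]

theorem variation_smul (c : ℝ≥0) (f : C_c(Y, ℝ≥0)) :
    μ.variation (c • f) = c * μ.variation f := by
  refine le_antisymm ?_ (μ.smul_variation_le c f)
  rcases eq_or_ne c 0 with rfl | hc
  · simp only [zero_smul, ENNReal.coe_zero, zero_mul, nonpos_iff_eq_zero]
    refine le_antisymm (iSup₂_le fun g hg => ?_) zero_le
    have : g = 0 := by
      ext y
      simpa using hg y
    simp [this]
  · have h := μ.smul_variation_le c⁻¹ (c • f)
    rw [smul_smul, inv_mul_cancel₀ hc, one_smul, ENNReal.coe_inv hc] at h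
    simpa using (ENNReal.mul_le_iff_le_inv (ENNReal.inv_ne_zero.2 ENNReal.coe_ne_top)
      (ENNReal.inv_ne_top.2 (ENNReal.coe_ne_zero.2 hc))).1 h

theorem exists_unimodular_mul (z : 𝕂) : ∃ u : 𝕂, ‖u‖ = 1 ∧ u * z = (‖z‖ : ℝ) := by
  rcases eq_or_ne z 0 with rfl | hz
  · exact ⟨1, by simp⟩
  · have hz' : (‖z‖ : 𝕂) ≠ 0 := by simpa using hz
    refine ⟨(‖z‖ : ℝ) / z, ?_, div_mul_cancel₀ _ hz⟩
    simp [hz]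

/-- Rotating each competitor by a unimodular scalar makes both values of `μ` nonnegative reals, so
that no cancellation occurs in their sum. -/
theorem le_variation_add (f₁ f₂ : C_c(Y, ℝ≥0)) :
    μ.variation f₁ + μ.variation f₂ ≤ μ.variation (f₁ + f₂) := by
  refine ENNReal.biSup_add_biSup_le' (p := fun g : C_c(Y, 𝕂) => ∀ y, ‖g y‖₊ ≤ f₁ y)
    (q := fun g : C_c(Y, 𝕂) => ∀ y, ‖g y‖₊ ≤ f₂ y) ⟨0, by simp⟩ ⟨0, by simp⟩
    fun g₁ hg₁ g₂ hg₂ => ?_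
  obtain ⟨u₁, hu₁, h₁⟩ := exists_unimodular_mul (μ.toLinearMap g₁)
  obtain ⟨u₂, hu₂, h₂⟩ := exists_unimodular_mul (μ.toLinearMap g₂)
  have h := μ.enorm_le_variation (g := u₁ • g₁ + u₂ • g₂) (f := f₁ + f₂) fun y => by
    refine (nnnorm_add_le _ _).trans ?_
    have e₁ : ‖u₁‖₊ = 1 := NNReal.eq hu₁
    have e₂ : ‖u₂‖₊ = 1 := NNReal.eq hu₂
    simpa [nnnorm_smul, e₁, e₂] using add_le_add (hg₁ y) (hg₂ y)
  refine le_trans (le_of_eq ?_) h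
  rw [map_add, map_smul, map_smul, smul_eq_mul, smul_eq_mul, h₁, h₂, ← RCLike.ofReal_add,
    ← ofReal_norm, ← ofReal_norm, ← ofReal_norm,
    ← ENNReal.ofReal_add (norm_nonneg _) (norm_nonneg _), RCLike.norm_ofReal,
    abs_of_nonneg (by positivity)]

/-- A function dominated by `f₁ + f₂` splits into two functions dominated by `f₁` and `f₂`. -/
theorem exists_add_eq_of_nnnorm_le {g : C_c(Y, 𝕂)} {f₁ f₂ : C_c(Y, ℝ≥0)}
    (hg : ∀ y, ‖g y‖₊ ≤ f₁ y + f₂ y) :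
    ∃ g₁ g₂ : C_c(Y, 𝕂), g₁ + g₂ = g ∧ (∀ y, ‖g₁ y‖₊ ≤ f₁ y) ∧ ∀ y, ‖g₂ y‖₊ ≤ f₂ y := by
  set q : Y → 𝕂 := fun y => (((f₁ y : ℝ) / (f₁ y + f₂ y) : ℝ) : 𝕂) * g y with hq
  have hg' : ∀ y, ‖g y‖ ≤ f₁ y + f₂ y := fun y => by exact_mod_cast hg y
  have hratio : ∀ y, 0 ≤ (f₁ y : ℝ) / (f₁ y + f₂ y) ∧ (f₁ y : ℝ) / (f₁ y + f₂ y) ≤ 1 :=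
    fun y => ⟨by positivity, div_le_one_of_le₀ (by simp) (by positivity)⟩
  have hqn : ∀ y, ‖q y‖ = (f₁ y : ℝ) / (f₁ y + f₂ y) * ‖g y‖ := fun y => by
    rw [hq]
    simp only [norm_mul, RCLike.norm_ofReal, abs_of_nonneg (hratio y).1]
  have hqc : Continuous q := by
    refine continuous_iff_continuousAt.2 fun y => ?_
    -- The quotient may be discontinuous at zeros of `f₁ + f₂`, but `g` vanishes there and dominates
    -- `q` in norm.
    rcases eq_or_ne ((f₁ y : ℝ) + f₂ y) 0 with h0 | h0
    · have hgy : g y = 0 := by simpa [h0] using hg' y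
      have hqy : q y = 0 := by simp [hq, hgy]
      rw [ContinuousAt, hqy]
      refine squeeze_zero_norm (a := fun z => ‖g z‖) (fun z => ?_) ?_
      · rw [hqn]
        exact mul_le_of_le_one_left (norm_nonneg _) (hratio z).2
      · simpa [hgy] using (g.continuous.norm.tendsto y)
    · refine ContinuousAt.mul ?_ g.continuous.continuousAt
      refine RCLike.continuous_ofReal.continuousAt.comp (ContinuousAt.div ?_ ?_ h0) <;>
        exact Continuous.continuousAt (by fun_prop)
  have hqs : HasCompactSupport q := g.hasCompactSupport.mul_left
  refine ⟨⟨⟨q, hqc⟩, hqs⟩, g - ⟨⟨q, hqc⟩, hqs⟩, add_sub_cancel _ _, fun y => ?_, fun y => ?_⟩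
  · rw [← NNReal.coe_le_coe, coe_nnnorm]
    change ‖q y‖ ≤ _
    rw [hqn]
    rcases eq_or_ne ((f₁ y : ℝ) + f₂ y) 0 with h0 | h0
    · simp [h0]
    · have hpos : 0 < (f₁ y : ℝ) + f₂ y := lt_of_le_of_ne (by positivity) h0.symm
      rw [div_mul_eq_mul_div, div_le_iff₀ hpos]
      exact mul_le_mul_of_nonneg_left (hg' y) (by positivity)
  · rw [← NNReal.coe_le_coe, coe_nnnorm]
    change ‖g y - q y‖ ≤ _
    have : g y - q y = ((1 - (f₁ y : ℝ) / (f₁ y + f₂ y) : ℝ) : 𝕂) * g y := by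
      simp only [hq]; push_cast; ring
    rw [this, norm_mul, RCLike.norm_ofReal, abs_of_nonneg (sub_nonneg.2 (hratio y).2)]
    rcases eq_or_ne ((f₁ y : ℝ) + f₂ y) 0 with h0 | h0
    · have hgy : g y = 0 := by simpa [h0] using hg' y
      simp [hgy]
    · have hpos : 0 < (f₁ y : ℝ) + f₂ y := lt_of_le_of_ne (by positivity) h0.symm
      rw [one_sub_div h0, add_sub_cancel_left, div_mul_eq_mul_div, div_le_iff₀ hpos]
      exact mul_le_mul_of_nonneg_left (hg' y) (by positivity)

theorem variation_add (f₁ f₂ : C_c(Y, ℝ≥0)) :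
    μ.variation (f₁ + f₂) = μ.variation f₁ + μ.variation f₂ := by
  refine le_antisymm (iSup₂_le fun g hg => ?_) (μ.le_variation_add f₁ f₂)
  obtain ⟨g₁, g₂, rfl, h₁, h₂⟩ := exists_add_eq_of_nnnorm_le hg
  rw [map_add]
  exact (enorm_add_le _ _).trans
    (add_le_add (μ.enorm_le_variation h₁) (μ.enorm_le_variation h₂))

/-- The total variation `|μ|` as a positive linear functional. -/
def variationLinear : C_c(Y, ℝ≥0) →ₗ[ℝ≥0] ℝ≥0 where
  toFun f := (μ.variation f).toNNReal
  map_add' f₁ f₂ := by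
    rw [variation_add, ENNReal.toNNReal_add (μ.variation_ne_top _) (μ.variation_ne_top _)]
  map_smul' c f := by simp [variation_smul]

theorem coe_variationLinear (f : C_c(Y, ℝ≥0)) : (μ.variationLinear f : ℝ≥0∞) = μ.variation f :=
  ENNReal.coe_toNNReal (μ.variation_ne_top f)

/-! ### The Borel measure of `|μ|` and formal properties of the upper integrals. -/

section Measure

variable [T2Space Y] [LocallyCompactSpace Y] [MeasurableSpace Y] [BorelSpace Y]

/-- The regular Borel measure representing `|μ|`. -/
def variationMeasure : Measure Y := NNRealRMK.rieszMeasure μ.variationLinear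

instance : μ.variationMeasure.Regular :=
  inferInstanceAs (NNRealRMK.rieszMeasure μ.variationLinear).Regular

theorem lintegral_variationMeasure (f : C_c(Y, ℝ≥0)) :
    ∫⁻ y, f y ∂μ.variationMeasure = μ.variation f := by
  rw [variationMeasure, NNRealRMK.lintegral_rieszMeasure, coe_variationLinear]

end Measure

theorem variation_le_lscIntegral {f : C_c(Y, ℝ≥0)} {h : Y → ℝ≥0∞}
    (hf : ∀ y, (f y : ℝ≥0∞) ≤ h y) : μ.variation f ≤ μ.lscIntegral h :=
  le_iSup₂ (f := fun (f : C_c(Y, ℝ≥0)) (_ : ∀ y, (f y : ℝ≥0∞) ≤ h y) => μ.variation f) f hf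

theorem lscIntegral_mono {h k : Y → ℝ≥0∞} (hk : ∀ y, h y ≤ k y) :
    μ.lscIntegral h ≤ μ.lscIntegral k :=
  iSup₂_le fun _ hf => μ.variation_le_lscIntegral fun y => (hf y).trans (hk y)

theorem lscIntegral_add_le (h k : Y → ℝ≥0∞) :
    μ.lscIntegral h + μ.lscIntegral k ≤ μ.lscIntegral (fun y => h y + k y) := by
  refine ENNReal.biSup_add_biSup_le' (p := fun f : C_c(Y, ℝ≥0) => ∀ y, (f y : ℝ≥0∞) ≤ h y)
    (q := fun f : C_c(Y, ℝ≥0) => ∀ y, (f y : ℝ≥0∞) ≤ k y) ⟨0, by simp⟩ ⟨0, by simp⟩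
    fun f hf g hg => ?_
  rw [← variation_add]
  exact μ.variation_le_lscIntegral fun y => by simpa using add_le_add (hf y) (hg y)

theorem sum_lscIntegral_le {ι : Type*} (s : Finset ι) (h : ι → Y → ℝ≥0∞) :
    ∑ i ∈ s, μ.lscIntegral (h i) ≤ μ.lscIntegral (fun y => ∑ i ∈ s, h i y) := by
  classical
  induction s using Finset.induction_on with
  | empty => simp
  | insert a s ha ih =>
    simp only [Finset.sum_insert ha]
    exact (add_le_add le_rfl ih).trans (μ.lscIntegral_add_le _ _)

theorem upperIntegral_le_lscIntegral {h k : Y → ℝ≥0∞} (hk : LowerSemicontinuous k)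
    (hhk : ∀ y, h y ≤ k y) : μ.upperIntegral h ≤ μ.lscIntegral k :=
  iInf_le_of_le k (iInf₂_le hk hhk)

theorem upperIntegral_mono {h k : Y → ℝ≥0∞} (hk : ∀ y, h y ≤ k y) :
    μ.upperIntegral h ≤ μ.upperIntegral k :=
  le_iInf fun _ => le_iInf₂ fun hl hkl =>
    μ.upperIntegral_le_lscIntegral hl fun y => (hk y).trans (hkl y)

theorem upperIntegral_indicator_le {K : Set Y} (hK : IsCompact K) (h : Y → ℝ≥0∞) :
    μ.upperIntegral (K.indicator h) ≤ μ.essUpperIntegral h :=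
  le_iSup₂ (f := fun (K : Set Y) (_ : IsCompact K) => μ.upperIntegral (K.indicator h)) K hK

theorem essUpperIntegral_mono {h k : Y → ℝ≥0∞} (hk : ∀ y, h y ≤ k y) :
    μ.essUpperIntegral h ≤ μ.essUpperIntegral k :=
  iSup₂_le fun _ hK => (μ.upperIntegral_mono fun _ => indicator_le_indicator (hk _)).trans
    (μ.upperIntegral_indicator_le hK k)

theorem sum_range_ite_le (t : ℝ≥0∞) {a : ℝ≥0} (m : ℕ) :
    ∑ i ∈ Finset.range m, (if (((i + 1 : ℕ) * a : ℝ≥0) : ℝ≥0∞) < t then (a : ℝ≥0∞) else 0) ≤ t := by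
  -- The induction needs the sharper bound by `m * a`: a step is added only while its top `(m + 1) *
  -- a` is still below `t`.
  suffices h : ∀ m : ℕ, ∑ i ∈ Finset.range m,
      (if (((i + 1 : ℕ) * a : ℝ≥0) : ℝ≥0∞) < t then (a : ℝ≥0∞) else 0) ≤
        min t ((m * a : ℝ≥0) : ℝ≥0∞) from (h m).trans (min_le_left _ _)
  intro m
  induction m with
  | zero => simp
  | succ m ih =>
    rw [Finset.sum_range_succ]
    split_ifs with hlt
    · rw [min_eq_right hlt.le]
      calc _ ≤ ((m * a : ℝ≥0) : ℝ≥0∞) + a := add_le_add (ih.trans (min_le_right _ _)) le_rfl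
        _ = _ := by rw [← ENNReal.coe_add]; congr 1; push_cast; ring
    · rw [add_zero, min_eq_left (not_lt.1 hlt)]
      exact ih.trans (min_le_left _ _)

theorem le_sum_range_ite {t : ℝ≥0∞} {a : ℝ≥0} {m : ℕ} (hm : ((m * a : ℝ≥0) : ℝ≥0∞) < t) {l : ℕ}
    (hl : m ≤ l) : ((m * a : ℝ≥0) : ℝ≥0∞) ≤
      ∑ i ∈ Finset.range l, (if (((i + 1 : ℕ) * a : ℝ≥0) : ℝ≥0∞) < t then (a : ℝ≥0∞) else 0) := by
  refine le_trans (le_of_eq ?_) (Finset.sum_le_sum_of_subset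
    (Finset.range_subset_range.2 hl))
  rw [Finset.sum_congr rfl (g := fun _ => (a : ℝ≥0∞))]
  · simp
  · intro i hi
    rw [if_pos]
    refine lt_of_le_of_lt ?_ hm
    have : i + 1 ≤ m := Finset.mem_range.1 hi
    gcongr

/-- The step function with `n²` steps of height `1 / n` below `k`. -/
def lowerStep (k : Y → ℝ≥0∞) (n : ℕ) (y : Y) : ℝ≥0∞ :=
  ∑ i ∈ Finset.range (n * n),
    {y | (((i + 1 : ℕ) / n : ℝ≥0) : ℝ≥0∞) < k y}.indicator (
      fun _ => (((n : ℝ≥0)⁻¹ : ℝ≥0) : ℝ≥0∞)) y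

omit [TopologicalSpace Y] in
theorem lowerStep_eq (k : Y → ℝ≥0∞) (n : ℕ) (y : Y) : lowerStep k n y =
    ∑ i ∈ Finset.range (n * n), (if (((i + 1 : ℕ) * (n : ℝ≥0)⁻¹ : ℝ≥0) : ℝ≥0∞) < k y
      then (((n : ℝ≥0)⁻¹ : ℝ≥0) : ℝ≥0∞) else 0) := by
  simp only [lowerStep, indicator_apply, mem_ofPred_eq, div_eq_mul_inv]

omit [TopologicalSpace Y] in
-- The `n²` steps of height `1 / n` reach height `n`, so both the mesh and the cutoff disappear in
-- the limit. The sequence need not be monotone in `n`, hence the `liminf`.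
theorem le_liminf_lowerStep (k : Y → ℝ≥0∞) (y : Y) :
    k y ≤ liminf (fun n => lowerStep k n y) atTop := by
  refine le_of_forall_lt fun r hr => ?_
  obtain ⟨s, hrs, hs⟩ := exists_between hr
  lift r to ℝ≥0 using (hrs.trans hs).ne_top
  lift s to ℝ≥0 using hs.ne_top
  refine lt_of_lt_of_le hrs (le_liminf_of_le (by isBoundedDefault) ?_)
  obtain ⟨u, hsu, hu⟩ := exists_between hs
  lift u to ℝ≥0 using hu.ne_top
  rw [ENNReal.coe_lt_coe] at hsu
  have hδ : (0 : ℝ) < u - s := sub_pos.2 hsu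
  filter_upwards [eventually_ge_atTop (⌈(u : ℝ)⌉₊ + 1),
    eventually_ge_atTop (⌈((u : ℝ) - s)⁻¹⌉₊ + 1)] with n hn1 hn2
  have hn0 : (0 : ℝ) < n := by exact_mod_cast (Nat.succ_pos _).trans_le hn1
  have hun : (u : ℝ) ≤ n := (Nat.le_ceil _).trans (by exact_mod_cast (Nat.le_succ _).trans hn1)
  have hdn : ((u : ℝ) - s)⁻¹ ≤ n :=
    (Nat.le_ceil _).trans (by exact_mod_cast (Nat.le_succ _).trans hn2)
  have hm1 : (⌊(u : ℝ) * n⌋₊ : ℝ) ≤ u * n := Nat.floor_le (by positivity)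
  have hm2 : (u : ℝ) * n < ⌊(u : ℝ) * n⌋₊ + 1 := Nat.lt_floor_add_one _
  -- With this `m`, the value `m / n` lies in `[s, u]` since `n ≥ 1 / (u - s)`, and `m ≤ n²` since
  -- `n ≥ u`.
  set m := ⌊(u : ℝ) * n⌋₊
  rw [lowerStep_eq]
  have hmu : (m * (n : ℝ≥0)⁻¹ : ℝ≥0) ≤ u := by
    rw [← NNReal.coe_le_coe]
    push_cast
    rwa [← div_eq_mul_inv, div_le_iff₀ hn0]
  have hsm : s ≤ (m * (n : ℝ≥0)⁻¹ : ℝ≥0) := by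
    rw [← NNReal.coe_le_coe]
    push_cast
    rw [← div_eq_mul_inv, le_div_iff₀ hn0]
    have : 1 ≤ ((u : ℝ) - s) * n := by
      rwa [inv_le_iff_one_le_mul₀' hδ] at hdn
    nlinarith
  refine le_trans (ENNReal.coe_le_coe.2 hsm) (le_sum_range_ite ?_ ?_)
  · exact (ENNReal.coe_le_coe.2 hmu).trans_lt hu
  · have : (m : ℝ) ≤ (n * n : ℕ) := by
      push_cast
      exact hm1.trans (by gcongr)
    exact_mod_cast this

/-! ### Upper integrals against Lebesgue integrals. -/

section Measure

variable [T2Space Y] [LocallyCompactSpace Y]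

theorem exists_compactlySupported_between {K U : Set Y} (hK : IsCompact K) (hU : IsOpen U)
    (hKU : K ⊆ U) : ∃ f : C_c(Y, ℝ≥0), (∀ y ∈ K, f y = 1) ∧ ∀ y, f y ≤ U.indicator 1 y := by
  obtain ⟨f, hf1, hfc, hfU, hf⟩ := exists_continuousMap_one_of_isCompact_subset_isOpen hK hU hKU
  refine ⟨⟨⟨fun y => (f y).toNNReal, by fun_prop⟩,
    HasCompactSupport.comp_left (g := Real.toNNReal) hfc Real.toNNReal_zero⟩,
    fun y hy => ?_, fun y => ?_⟩
  · change (f y).toNNReal = 1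
    simp [hf1 hy]
  · change (f y).toNNReal ≤ _
    by_cases hy : y ∈ U
    · simpa [hy] using (hf y).2
    · simp [hy, image_eq_zero_of_notMem_tsupport fun h => hy (hfU h)]

variable [MeasurableSpace Y] [BorelSpace Y]

theorem lscIntegral_le_lintegral (h : Y → ℝ≥0∞) :
    μ.lscIntegral h ≤ ∫⁻ y, h y ∂μ.variationMeasure :=
  iSup₂_le fun f hf => by
    rw [← lintegral_variationMeasure]
    exact lintegral_mono hf

/-- Inner regularity on open sets reduces `U` to compact `K ⊆ U`, and a Urysohn function between `K`
and `U` is a competitor. -/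
theorem mul_variationMeasure_le {U : Set Y} (hU : IsOpen U) (c : ℝ≥0) :
    c * μ.variationMeasure U ≤ μ.lscIntegral (U.indicator fun _ => (c : ℝ≥0∞)) := by
  rw [hU.measure_eq_iSup_isCompact]
  simp only [ENNReal.mul_iSup]
  refine iSup_le fun K => iSup_le fun hKU => iSup_le fun hK => ?_
  obtain ⟨f, hfK, hfU⟩ := exists_compactlySupported_between hK hU hKU
  refine le_trans ?_ (μ.variation_le_lscIntegral (f := c • f) fun y => ?_)
  · rw [variation_smul, ← lintegral_variationMeasure]
    gcongr
    rw [← lintegral_indicator_one hK.measurableSet]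
    refine lintegral_mono fun y => ?_
    by_cases hy : y ∈ K <;> simp [hy, hfK]
  · have := hfU y
    by_cases hy : y ∈ U
    · simp only [hy, indicator_of_mem, Pi.one_apply] at this
      simp only [CompactlySupportedContinuousMap.coe_smul, Pi.smul_apply, smul_eq_mul, hy,
        indicator_of_mem]
      exact_mod_cast mul_le_of_le_one_right zero_le this
    · simp only [hy, not_false_eq_true, indicator_of_notMem, nonpos_iff_eq_zero] at this
      simp [hy, this]

theorem lintegral_lowerStep_le {k : Y → ℝ≥0∞} (hk : LowerSemicontinuous k) (n : ℕ) :
    ∫⁻ y, lowerStep k n y ∂μ.variationMeasure ≤ μ.lscIntegral k := by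
  have hopen : ∀ t : ℝ≥0∞, IsOpen {y | t < k y} := fun t => hk.isOpen_preimage t
  simp only [lowerStep]
  rw [lintegral_finsetSum _ fun i _ => measurable_const.indicator (hopen _).measurableSet]
  calc _ ≤ ∑ i ∈ Finset.range (n * n), μ.lscIntegral
        ({y | (((i + 1 : ℕ) / n : ℝ≥0) : ℝ≥0∞) < k y}.indicator
          (fun _ => (((n : ℝ≥0)⁻¹ : ℝ≥0) : ℝ≥0∞))) := by
        refine Finset.sum_le_sum fun i _ => ?_
        rw [lintegral_indicator (hopen _).measurableSet, setLIntegral_const]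
        exact μ.mul_variationMeasure_le (hopen _) _
    _ ≤ _ := (μ.sum_lscIntegral_le _ _).trans (μ.lscIntegral_mono fun y => ?_)
  change lowerStep k n y ≤ k y
  rw [lowerStep_eq]
  exact sum_range_ite_le _ _

/-- The superlevel sets of `k` are open, so superadditivity bounds the integrals of the step
functions; Fatou's lemma passes to the limit. -/
theorem lscIntegral_eq_lintegral {k : Y → ℝ≥0∞} (hk : LowerSemicontinuous k) :
    μ.lscIntegral k = ∫⁻ y, k y ∂μ.variationMeasure := by
  refine le_antisymm (μ.lscIntegral_le_lintegral k) ?_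
  have hopen : ∀ t : ℝ≥0∞, IsOpen {y | t < k y} := fun t => hk.isOpen_preimage t
  calc ∫⁻ y, k y ∂μ.variationMeasure
      ≤ ∫⁻ y, liminf (fun n => lowerStep k n y) atTop ∂μ.variationMeasure :=
        lintegral_mono (le_liminf_lowerStep k)
    _ ≤ liminf (fun n => ∫⁻ y, lowerStep k n y ∂μ.variationMeasure) atTop :=
        lintegral_liminf_le fun n => Finset.measurable_fun_sum _ fun i _ =>
          measurable_const.indicator (hopen _).measurableSet
    _ ≤ μ.lscIntegral k :=
        (liminf_le_liminf (Eventually.of_forall (μ.lintegral_lowerStep_le hk))).trans (by simp)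

theorem lintegral_le_upperIntegral (h : Y → ℝ≥0∞) :
    ∫⁻ y, h y ∂μ.variationMeasure ≤ μ.upperIntegral h :=
  le_iInf fun _ => le_iInf₂ fun hk hhk => by
    rw [μ.lscIntegral_eq_lintegral hk]
    exact lintegral_mono hhk

theorem upperIntegral_le_lintegral {h : Y → ℝ≥0∞} (hh : Measurable h) :
    μ.upperIntegral h ≤ ∫⁻ y, h y ∂μ.variationMeasure := by
  refine ENNReal.le_of_forall_pos_le_add fun ε hε _ => ?_
  obtain ⟨k, hhk, hk, hle⟩ := exists_le_lowerSemicontinuous_lintegral_ge μ.variationMeasure h hh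
    (ENNReal.coe_ne_zero.2 hε.ne')
  exact ((μ.upperIntegral_le_lscIntegral hk hhk).trans (μ.lscIntegral_le_lintegral k)).trans hle

theorem upperIntegral_le_lintegral_of_aemeasurable {h : Y → ℝ≥0∞}
    (hh : AEMeasurable h μ.variationMeasure) :
    μ.upperIntegral h ≤ ∫⁻ y, h y ∂μ.variationMeasure := by
  classical
  set N := toMeasurable μ.variationMeasure {y | h y ≠ hh.mk h y} with hN
  have hN0 : μ.variationMeasure N = 0 := by
    rw [measure_toMeasurable]
    exact hh.ae_eq_mk
  have hNm : MeasurableSet N := measurableSet_toMeasurable _ _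
  calc μ.upperIntegral h
      -- The value `∞` on a measurable null set gives a Borel majorant everywhere, with the same
      -- integral.
      ≤ μ.upperIntegral (fun y => hh.mk h y + N.indicator (fun _ => ∞) y) := by
        refine μ.upperIntegral_mono fun y => ?_
        by_cases hy : y ∈ N
        · simp [hy]
        · have : h y = hh.mk h y := by
            by_contra hne
            exact hy (subset_toMeasurable _ _ hne)
          simp [hy, this]
    _ ≤ ∫⁻ y, hh.mk h y + N.indicator (fun _ => ∞) y ∂μ.variationMeasure :=
        μ.upperIntegral_le_lintegral
          (hh.measurable_mk.add (measurable_const.indicator hNm))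
    _ = ∫⁻ y, h y ∂μ.variationMeasure := by
        rw [lintegral_add_left hh.measurable_mk, lintegral_indicator hNm, setLIntegral_const, hN0,
          mul_zero, add_zero]
        exact lintegral_congr_ae hh.ae_eq_mk.symm

/-- Subadditivity on lower semicontinuous majorants comes from additivity of the Lebesgue integral.
-/
theorem upperIntegral_add_le (h k : Y → ℝ≥0∞) :
    μ.upperIntegral (fun y => h y + k y) ≤ μ.upperIntegral h + μ.upperIntegral k := by
  rw [upperIntegral.eq_1 μ h, upperIntegral.eq_1 μ k]
  simp only [iInf_and', ENNReal.iInf_add, ENNReal.add_iInf]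
  refine le_iInf fun k' => le_iInf fun hk' => le_iInf fun h' => le_iInf fun hh' => ?_
  have hk : LowerSemicontinuous fun y => h' y + k' y := hh'.1.add hk'.1
  refine (μ.upperIntegral_le_lscIntegral hk fun y => add_le_add (hh'.2 y) (hk'.2 y)).trans ?_
  rw [μ.lscIntegral_eq_lintegral hk, μ.lscIntegral_eq_lintegral hh'.1,
    μ.lscIntegral_eq_lintegral hk'.1, lintegral_add_left hh'.1.measurable]

theorem setLIntegral_le_essUpperIntegral {K : Set Y} (hK : IsCompact K) (h : Y → ℝ≥0∞) :
    ∫⁻ y in K, h y ∂μ.variationMeasure ≤ μ.essUpperIntegral h := by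
  rw [← lintegral_indicator hK.measurableSet]
  exact (μ.lintegral_le_upperIntegral _).trans (μ.upperIntegral_indicator_le hK h)

theorem essUpperIntegral_le_iSup_setLIntegral {h : Y → ℝ≥0∞}
    (hh : ∀ K, IsCompact K → AEMeasurable h (μ.variationMeasure.restrict K)) :
    μ.essUpperIntegral h ≤ ⨆ (K : Set Y) (_ : IsCompact K), ∫⁻ y in K, h y ∂μ.variationMeasure :=
  iSup₂_mono fun K hK => by
    rw [← lintegral_indicator hK.measurableSet]
    exact μ.upperIntegral_le_lintegral_of_aemeasurable
      ((aemeasurable_indicator_iff hK.measurableSet).2 (hh K hK))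

theorem variation_le_essUpperIntegral (f : C_c(Y, ℝ≥0)) :
    μ.variation f ≤ μ.essUpperIntegral fun y => f y := by
  rw [← lintegral_variationMeasure]
  refine le_trans (le_of_eq ?_) (μ.setLIntegral_le_essUpperIntegral f.hasCompactSupport _)
  rw [setLIntegral_eq_of_support_subset]
  exact fun y hy => subset_tsupport _ (by simpa using hy)

end Measure

/-! ### Measurable maps and dominated convergence. -/

theorem IsMeasurableMap.comp {μ : RadonMeasure 𝕂 Y} {F G : Type*} [TopologicalSpace F]
    [TopologicalSpace G] {f : Y → F} (hf : μ.IsMeasurableMap f) {g : F → G} (hg : Continuous g) :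
    μ.IsMeasurableMap fun y => g (f y) := fun K hK ε hε => by
  obtain ⟨K₁, hK₁, hsub, hcont, hle⟩ := hf K hK ε hε
  exact ⟨K₁, hK₁, hsub, hg.comp_continuousOn hcont, hle⟩

section Borel

variable [T2Space Y] [LocallyCompactSpace Y] [MeasurableSpace Y] [BorelSpace Y]

/-- Countably many compact sets on which `f` is continuous exhaust `K` up to a null set. -/
theorem IsMeasurableMap.aemeasurable {μ : RadonMeasure 𝕂 Y} {F : Type*} [TopologicalSpace F]
    [MeasurableSpace F] [BorelSpace F] {f : Y → F}
    (hf : μ.IsMeasurableMap f) {K : Set Y} (hK : IsCompact K) :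
    AEMeasurable f (μ.variationMeasure.restrict K) := by
  choose L hLc hLK hLf hLμ using fun n : ℕ => hf K hK ((n : ℝ≥0∞) + 1)⁻¹ (by simp)
  have hLm : ∀ n, MeasurableSet (L n) := fun n => (hLc n).measurableSet
  have hK' : μ.variationMeasure (K \ ⋃ n, L n) = 0 := by
    refine le_antisymm (ge_of_tendsto' (x := atTop) (f := fun n : ℕ => ((n : ℝ≥0∞) + 1)⁻¹)
      ?_ fun n => ?_) zero_le
    · have := (tendsto_add_atTop_iff_nat 1).2 ENNReal.tendsto_inv_nat_nhds_zero
      simpa using this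
    · calc μ.variationMeasure (K \ ⋃ n, L n) ≤ μ.variationMeasure (K \ L n) :=
            measure_mono (sdiff_subset_sdiff_right (subset_iUnion L n))
        _ = ∫⁻ y, (K \ L n).indicator 1 y ∂μ.variationMeasure :=
            (lintegral_indicator_one (hK.measurableSet.diff (hLm n))).symm
        _ ≤ _ := (μ.lintegral_le_upperIntegral _).trans (hLμ n)
  have hU : AEMeasurable f (μ.variationMeasure.restrict (⋃ n, L n)) :=
    aemeasurable_iUnion_iff.2 fun n => (hLf n).aemeasurable (hLm n)
  refine hU.mono_ac (Measure.AbsolutelyContinuous.mk fun s hs h0 => ?_)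
  rw [Measure.restrict_apply hs] at h0 ⊢
  refine measure_mono_null (t := s ∩ (⋃ n, L n) ∪ K \ ⋃ n, L n) (fun y hy => ?_)
    (measure_union_null h0 hK')
  by_cases h : y ∈ ⋃ n, L n
  · exact Or.inl ⟨hy.1, h⟩
  · exact Or.inr ⟨hy.2, h⟩

end Borel

variable [T2Space Y] [LocallyCompactSpace Y]

/-- Dominated convergence for the essential upper integral. -/
theorem tendsto_essUpperIntegral_zero {g : ℕ → Y → ℝ≥0∞} (hg : ∀ n, μ.IsMeasurableMap (g n))
    {G : Y → ℝ≥0∞} (hG : μ.essUpperIntegral G ≠ ∞) (hle : ∀ n y, g n y ≤ G y)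
    (hlim : ∀ y, Tendsto (fun n => g n y) atTop (𝓝 0)) :
    Tendsto (fun n => μ.essUpperIntegral (g n)) atTop (𝓝 0) := by
  let : MeasurableSpace Y := borel Y
  have : BorelSpace Y := ⟨rfl⟩
  set m := μ.variationMeasure
  have hgm : ∀ n K, IsCompact K → AEMeasurable (g n) (m.restrict K) :=
    fun n K hK => (hg n).aemeasurable hK
  -- `G` may fail to be measurable; this countable supremum is a.e. measurable on compact sets and
  -- still dominates.
  set G₀ : Y → ℝ≥0∞ := fun y => ⨆ n, g n y with hG₀
  have hG₀m : ∀ K, IsCompact K → AEMeasurable G₀ (m.restrict K) :=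
    fun K hK => AEMeasurable.iSup fun n => hgm n K hK
  set S : ℝ≥0∞ := ⨆ (K : Set Y) (_ : IsCompact K), ∫⁻ y in K, G₀ y ∂m with hS
  have hle_S : ∀ K, IsCompact K → ∫⁻ y in K, G₀ y ∂m ≤ S := fun K hK =>
    le_iSup₂ (f := fun (K : Set Y) (_ : IsCompact K) => ∫⁻ y in K, G₀ y ∂m) K hK
  have hS_top : S ≠ ∞ := ne_top_of_le_ne_top hG <| iSup₂_le fun K hK =>
    (μ.setLIntegral_le_essUpperIntegral hK G₀).trans
      (μ.essUpperIntegral_mono fun y => iSup_le fun n => hle n y)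
  refine ENNReal.tendsto_nhds_zero.2 fun ε hε => ?_
  have hε2 : ε / 2 ≠ 0 := (ENNReal.half_pos hε.ne').ne'
  -- Since `K₀` nearly attains the finite supremum `S`, any compact set contributes at most `ε / 2`
  -- outside `K₀`, uniformly in `n`. Only `K₀` is left for the usual dominated convergence.
  obtain ⟨K₀, hK₀, hK₀S⟩ : ∃ K₀, IsCompact K₀ ∧ S ≤ ∫⁻ y in K₀, G₀ y ∂m + ε / 2 := by
    rcases eq_or_ne S 0 with h0 | h0
    · exact ⟨∅, isCompact_empty, by simp [h0]⟩
    · have hlt : S - ε / 2 < S := ENNReal.sub_lt_self hS_top h0 hε2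
      obtain ⟨K₀, hK₀⟩ := lt_iSup_iff.1 (hlt.trans_eq hS)
      obtain ⟨hK₀c, hK₀'⟩ := lt_iSup_iff.1 hK₀
      exact ⟨K₀, hK₀c, tsub_le_iff_right.1 hK₀'.le⟩
  have hfar : ∀ K, IsCompact K → ∫⁻ y in K \ K₀, G₀ y ∂m ≤ ε / 2 := fun K hK => by
    have h1 := (hle_S _ (hK₀.union hK)).trans hK₀S
    rw [← union_sdiff_self, lintegral_union (hK.measurableSet.diff hK₀.measurableSet)
      disjoint_sdiff_right] at h1
    exact (ENNReal.add_le_add_iff_left (ne_top_of_le_ne_top hS_top (hle_S _ hK₀))).1 h1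
  have hnear : Tendsto (fun n => ∫⁻ y in K₀, g n y ∂m) atTop (𝓝 0) := by
    simpa using tendsto_lintegral_of_dominated_convergence' G₀ (fun n => hgm n K₀ hK₀)
      (fun n => Eventually.of_forall fun y => le_iSup (fun n => g n y) n)
      (ne_top_of_le_ne_top hS_top (hle_S _ hK₀)) (Eventually.of_forall hlim)
  filter_upwards [ENNReal.tendsto_nhds_zero.1 hnear (ε / 2) (ENNReal.half_pos hε.ne')] with n hn
  refine (μ.essUpperIntegral_le_iSup_setLIntegral (hgm n)).trans (iSup₂_le fun K hK => ?_)
  calc ∫⁻ y in K, g n y ∂m ≤ ∫⁻ y in K₀ ∪ K \ K₀, g n y ∂m :=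
        lintegral_mono_set (by rw [union_sdiff_self]; exact subset_union_right)
    _ ≤ ∫⁻ y in K₀, g n y ∂m + ∫⁻ y in K \ K₀, g n y ∂m := lintegral_union_le _ _ _
    _ ≤ ε / 2 + ε / 2 := add_le_add hn <|
        (lintegral_mono fun y => le_iSup (fun n => g n y) n).trans (hfar K hK)
    _ = ε := ENNReal.add_halves ε

/-! ### Integrals of scalar and vector valued maps -/

theorem enorm_toLinearMap_le (g : C_c(Y, 𝕂)) :
    ‖μ.toLinearMap g‖ₑ ≤ μ.essUpperIntegral fun y => ‖g y‖ₑ := by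
  let : MeasurableSpace Y := borel Y
  have : BorelSpace Y := ⟨rfl⟩
  let f : C_c(Y, ℝ≥0) := ⟨⟨fun y => ‖g y‖₊, by fun_prop⟩,
    g.hasCompactSupport.comp_left (g := fun z : 𝕂 => ‖z‖₊) nnnorm_zero⟩
  exact (μ.enorm_le_variation (f := f) fun y => le_rfl).trans (μ.variation_le_essUpperIntegral f)

theorem essUpperIntegral_add_le (h k : Y → ℝ≥0∞) :
    μ.essUpperIntegral (fun y => h y + k y) ≤ μ.essUpperIntegral h + μ.essUpperIntegral k := by
  let : MeasurableSpace Y := borel Y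
  have : BorelSpace Y := ⟨rfl⟩
  refine iSup₂_le fun K hK => ?_
  rw [show K.indicator (fun y => h y + k y) = fun y => K.indicator h y + K.indicator k y from
    indicator_add K h k]
  exact (μ.upperIntegral_add_le _ _).trans (add_le_add (μ.upperIntegral_indicator_le hK h)
    (μ.upperIntegral_indicator_le hK k))

variable {μ} in
theorem HasScalarIntegral.enorm_le {f : Y → 𝕂} {z : 𝕂} (h : μ.HasScalarIntegral f z) :
    ‖z‖ₑ ≤ μ.essUpperIntegral fun y => ‖f y‖ₑ := by
  refine ENNReal.le_of_forall_pos_le_add fun ε hε _ => ?_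
  obtain ⟨g, hg, hz⟩ := h (ε / 2) (ENNReal.half_pos (by simpa using hε.ne'))
  calc ‖z‖ₑ = ‖μ.toLinearMap g - (μ.toLinearMap g - z)‖ₑ := by rw [sub_sub_cancel]
    _ ≤ ‖μ.toLinearMap g‖ₑ + ‖μ.toLinearMap g - z‖ₑ := enorm_sub_le
    _ ≤ (μ.essUpperIntegral fun y => ‖g y‖ₑ) + ε / 2 :=
        add_le_add (μ.enorm_toLinearMap_le g) hz.le
    _ ≤ ((μ.essUpperIntegral fun y => ‖f y‖ₑ) + ε / 2) + ε / 2 := by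
        gcongr
        refine (μ.essUpperIntegral_mono (k := fun y => ‖f y‖ₑ + ‖f y - g y‖ₑ) fun y => ?_).trans
          ((μ.essUpperIntegral_add_le _ _).trans (add_le_add le_rfl hg.le))
        calc ‖g y‖ₑ = ‖f y - (f y - g y)‖ₑ := by rw [sub_sub_cancel]
          _ ≤ _ := enorm_sub_le
    _ = _ := by rw [add_assoc, ENNReal.add_halves]

variable {μ} in
theorem HasScalarIntegral.sub {f₁ f₂ : Y → 𝕂} {z₁ z₂ : 𝕂} (h₁ : μ.HasScalarIntegral f₁ z₁)
    (h₂ : μ.HasScalarIntegral f₂ z₂) :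
    μ.HasScalarIntegral (fun y => f₁ y - f₂ y) (z₁ - z₂) := fun ε hε => by
  obtain ⟨g₁, hg₁, hz₁⟩ := h₁ (ε / 2) (ENNReal.half_pos hε.ne')
  obtain ⟨g₂, hg₂, hz₂⟩ := h₂ (ε / 2) (ENNReal.half_pos hε.ne')
  refine ⟨g₁ - g₂, ?_, ?_⟩
  · refine lt_of_le_of_lt (μ.essUpperIntegral_mono
      (k := fun y => ‖f₁ y - g₁ y‖ₑ + ‖f₂ y - g₂ y‖ₑ) fun y => ?_)
      (((μ.essUpperIntegral_add_le _ _).trans_lt (ENNReal.add_lt_add hg₁ hg₂)).trans_eq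
        (ENNReal.add_halves ε))
    rw [CompactlySupportedContinuousMap.coe_sub, Pi.sub_apply, sub_sub_sub_comm]
    exact enorm_sub_le
  · rw [map_sub, sub_sub_sub_comm]
    exact enorm_sub_le.trans_lt ((ENNReal.add_lt_add hz₁ hz₂).trans_eq (ENNReal.add_halves ε))

variable {F : Type*} [AddCommGroup F] [Module 𝕂 F] [TopologicalSpace F]

variable {μ} in
theorem HasIntegral.sub {f₁ f₂ : Y → F} {e₁ e₂ : F} (h₁ : μ.HasIntegral f₁ e₁)
    (h₂ : μ.HasIntegral f₂ e₂) : μ.HasIntegral (fun y => f₁ y - f₂ y) (e₁ - e₂) := fun φ => by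
  simpa only [map_sub] using (h₁ φ).sub (h₂ φ)

omit [T2Space Y] [LocallyCompactSpace Y] in
variable {μ} in
theorem MemL1.hasIntegral {f : Y → F} (h : μ.MemL1 f) : μ.HasIntegral f (μ.integral f) := by
  rw [integral, dif_pos h]
  exact h.choose_spec

/-- Hahn–Banach applied to `t • e ↦ t * p e` on the line through `e`; this is well defined because
`p e ≠ 0` forces `e ≠ 0`. -/
theorem _root_.Seminorm.exists_continuous_dual_apply_eq [PolynormableSpace 𝕂 F]
    {p : Seminorm 𝕂 F} (hp : Continuous p) (e : F) :
    ∃ φ : F →L[𝕂] 𝕂, (∀ x, ‖φ x‖ ≤ p x) ∧ ‖φ e‖ = p e := by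
  rcases eq_or_ne (p e) 0 with h0 | h0
  · exact ⟨0, by simp, by simp [h0]⟩
  · have he : e ≠ 0 := fun h => h0 (by rw [h, map_zero])
    let c := LinearEquiv.coord 𝕂 F e he
    obtain ⟨φ, hφ, hle⟩ := Module.Dual.exists_continuous_extension_of_le_seminorm
      (𝕂 ∙ e) (((p e : ℝ) : 𝕂) • (c : (𝕂 ∙ e) →ₗ[𝕂] 𝕂)) hp fun x => by
        have hx : c x • e = x := LinearEquiv.coord_apply_smul 𝕂 F e he x
        conv_rhs => rw [← hx, map_smul_eq_mul]
        simp [norm_smul, abs_of_nonneg (apply_nonneg p e), mul_comm]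
    refine ⟨φ, hle, ?_⟩
    have h1 : c ⟨e, Submodule.mem_span_singleton_self e⟩ = 1 := LinearEquiv.coord_self 𝕂 F e he
    have h2 := hφ ⟨e, Submodule.mem_span_singleton_self e⟩
    rw [h2]
    simp [h1, abs_of_nonneg (apply_nonneg p e)]

variable {μ} in
theorem HasIntegral.seminorm_le [PolynormableSpace 𝕂 F] {f : Y → F} {e : F}
    (h : μ.HasIntegral f e) {p : Seminorm 𝕂 F} (hp : Continuous p) :
    ENNReal.ofReal (p e) ≤ μ.essUpperIntegral fun y => ENNReal.ofReal (p (f y)) := by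
  obtain ⟨φ, hφ, he⟩ := p.exists_continuous_dual_apply_eq hp e
  rw [← he, ofReal_norm]
  refine (h φ).enorm_le.trans (μ.essUpperIntegral_mono fun y => ?_)
  rw [← ofReal_norm]
  exact ENNReal.ofReal_le_ofReal (hφ _)

end RadonMeasure

/-! ### Continuity of selections at a point, by comparison with a section. -/

namespace OmegaBundle

variable {𝕂 X J : Type*} [RCLike 𝕂] [TopologicalSpace X] {E : X → Type*}
  [∀ x, AddCommGroup (E x)] [∀ x, Module 𝕂 (E x)] [∀ x, TopologicalSpace (E x)]
  (V : OmegaBundle 𝕂 X J E)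

/-- A selection that is continuous at `x` approaches every section through the same point. -/
theorem tendsto_seminorm_sub {x : X} {σ η : ∀ z, E z} (hσ : σ ∈ V.sectionsAt x)
    (hη : η ∈ V.sections) (h : σ x = η x) (j : J) :
    Tendsto (fun z => V.ν j z (σ z - η z)) (𝓝 x) (𝓝 0) := by
  let := V.top
  refine Metric.tendsto_nhds.2 fun ε hε => ?_
  have hopen := V.isOpen_tube univ η isOpen_univ hη.2.continuousOn
    (fun i => by simpa [image_univ] using hη.1 i) j ε hε
  have hmem : (⟨x, σ x⟩ : TotalFibres E) ∈
      {b : TotalFibres E | b.base ∈ univ ∧ V.ν j b.base (b.vec - η b.base) < ε} := by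
    simp [h, hε]
  filter_upwards [hσ.2.preimage_mem_nhds (hopen.mem_nhds hmem)] with z hz
  rw [Real.dist_0_eq_abs, abs_of_nonneg (apply_nonneg _ _)]
  exact hz.2

/-- A bounded selection that approaches a section at `x` is continuous at `x`. -/
theorem mem_sectionsAt_of_tendsto {x : X} {σ η : ∀ z, E z} (hσ : σ ∈ V.boundedSelections)
    (hη : η ∈ V.sections) (h : σ x = η x)
    (hlim : ∀ j, Tendsto (fun z => V.ν j z (σ z - η z)) (𝓝 x) (𝓝 0)) :
    σ ∈ V.sectionsAt x := by
  let := V.top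
  refine ⟨hσ, fun W hW => ?_⟩
  obtain ⟨U, ρ, j, ε, hU, hxU, hρc, hρb, hε, hlt, hsub⟩ := V.exists_tube _ W hW
  simp only [h] at hxU hlt
  -- Near `x` the section `η` stays in the tube of radius `δ`, leaving `ε - δ` for the distance from
  -- `σ` to `η`.
  obtain ⟨δ, hδ, hδε⟩ := exists_between hlt
  have hδ0 : 0 < δ := (apply_nonneg _ _).trans_lt hδ
  have hopen := V.isOpen_tube U ρ hU hρc hρb j δ hδ0
  have hmem : (⟨x, η x⟩ : TotalFibres E) ∈
      {b : TotalFibres E | b.base ∈ U ∧ V.ν j b.base (b.vec - ρ b.base) < δ} := ⟨hxU, hδ⟩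
  refine mem_map.2 ?_
  filter_upwards [hη.2.continuousAt.preimage_mem_nhds (hopen.mem_nhds hmem),
    (hlim j).eventually_lt_const (sub_pos.2 hδε)] with z hz hz'
  refine hsub ⟨hz.1, ?_⟩
  have hz2 : V.ν j z (η z - ρ z) < δ := hz.2
  calc V.ν j z (σ z - ρ z) = V.ν j z ((σ z - η z) + (η z - ρ z)) := by rw [sub_add_sub_cancel]
    _ ≤ _ := map_add_le_add _ _ _
    _ < ε := by linarith

end OmegaBundle

/-! ### Integration of selections and the theorem. -/

section Related

variable {𝕂 X Y J : Type*} [RCLike 𝕂] [TopologicalSpace X] [TopologicalSpace Y] {E : X → Type*}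
  [∀ x, AddCommGroup (E x)] [∀ x, Module 𝕂 (E x)] [∀ x, TopologicalSpace (E x)]
  {T : ∀ x, Submodule 𝕂 (Y → E x)} [T2Space Y] [LocallyCompactSpace Y]
  {μ : RadonMeasure 𝕂 Y} {V : OmegaBundle 𝕂 X J E}
  {Z : OmegaBundle 𝕂 X (Finset (Y × J)) (fun x => T x)}

theorem MuRelated.integrateSelection_mem_boundedSelections (hVZ : MuRelated μ V Z)
    {A : Set (∀ x, T x)} {H : ∀ x, T x} (hH : H ∈ uniformlyIntegrable μ V A) :
    integrateSelection μ H ∈ V.boundedSelections := fun j => by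
  refine ⟨(μ.essUpperIntegral
    (fun s => ⨆ x, ENNReal.ofReal (V.ν j x ((H x : Y → E x) s)))).toReal, ?_⟩
  rintro _ ⟨x, rfl⟩
  have : PolynormableSpace 𝕂 (E x) := (V.withSeminorms x).toPolynormableSpace
  refine (ENNReal.ofReal_le_iff_le_toReal (hH.2 j).ne).1 ?_
  exact ((hVZ.memL1 x _ (H x).2).hasIntegral.seminorm_le
    ((V.withSeminorms x).continuous_seminorm j)).trans
    (μ.essUpperIntegral_mono fun s =>
      le_iSup (fun x => ENNReal.ofReal (V.ν j x ((H x : Y → E x) s))) x)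

theorem MuRelated.tendsto_integrateSelection_sub [FirstCountableTopology X]
    (hVZ : MuRelated μ V Z) {x : X} {A B : Set (∀ x, T x)} {H η : ∀ x, T x}
    (hH : H ∈ uniformlyIntegrable μ V A) (hη : η ∈ uniformlyIntegrable μ V B) (j : J)
    (hlim : ∀ s, Tendsto (fun z => V.ν j z ((H z : Y → E z) s - (η z : Y → E z) s)) (𝓝 x) (𝓝 0)) :
    Tendsto (fun z => V.ν j z (integrateSelection μ H z - integrateSelection μ η z)) (𝓝 x)
      (𝓝 0) := by
  -- First countability enters here: dominated convergence is only available along sequences.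
  refine tendsto_of_seq_tendsto fun u hu => ?_
  have hdom := μ.tendsto_essUpperIntegral_zero
    (g := fun n s => ENNReal.ofReal
      (V.ν j (u n) ((H (u n) : Y → E (u n)) s - (η (u n) : Y → E (u n)) s)))
    (fun n => ?_) (G := fun s => (⨆ x, ENNReal.ofReal (V.ν j x ((H x : Y → E x) s))) +
      ⨆ x, ENNReal.ofReal (V.ν j x ((η x : Y → E x) s)))
    (ne_top_of_le_ne_top (ENNReal.add_ne_top.2 ⟨(hH.2 j).ne, (hη.2 j).ne⟩)
      (μ.essUpperIntegral_add_le _ _)) (fun n s => ?_) (fun s => ?_)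
  · refine (ENNReal.tendsto_toReal_zero_iff (fun n => ENNReal.ofReal_ne_top)).2
      (tendsto_of_tendsto_of_tendsto_of_le_of_le tendsto_const_nhds hdom (fun _ => zero_le)
        fun n => ?_) |>.congr fun n => ENNReal.toReal_ofReal (apply_nonneg _ _)
    have : PolynormableSpace 𝕂 (E (u n)) := (V.withSeminorms (u n)).toPolynormableSpace
    exact ((hVZ.memL1 _ _ (H (u n)).2).hasIntegral.sub
      (hVZ.memL1 _ _ (η (u n)).2).hasIntegral).seminorm_le
      ((V.withSeminorms (u n)).continuous_seminorm j)
  · exact (hVZ.measurable (u n) _ (H (u n) - η (u n)).2).comp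
      (ENNReal.continuous_ofReal.comp ((V.withSeminorms (u n)).continuous_seminorm j))
  · refine (ENNReal.ofReal_le_ofReal (map_sub_le_add _ _ _)).trans
      (ENNReal.ofReal_add_le.trans (add_le_add ?_ ?_))
    · exact le_iSup (fun x => ENNReal.ofReal (V.ν j x ((H x : Y → E x) s))) (u n)
    · exact le_iSup (fun x => ENNReal.ofReal (V.ν j x ((η x : Y → E x) s))) (u n)
  · simpa using ENNReal.tendsto_ofReal ((hlim s).comp hu)

end Related

end

theorem theorem15101701 {𝕂 X Y J : Type*} [RCLike 𝕂]
    [TopologicalSpace X] [FirstCountableTopology X]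
    [TopologicalSpace Y] [T2Space Y] [LocallyCompactSpace Y] (μ : RadonMeasure 𝕂 Y)
    {E : X → Type*} [∀ x, AddCommGroup (E x)] [∀ x, Module 𝕂 (E x)]
    [∀ x, TopologicalSpace (E x)] (V : OmegaBundle 𝕂 X J E)
    {T : ∀ x, Submodule 𝕂 (Y → E x)}
    (Z : OmegaBundle 𝕂 X (Finset (Y × J)) (fun x => T x))
    (hVZ : MuRelated μ V Z) (x : X) :
    integrateSelection μ '' uniformlyIntegrable μ V (Z.diamondSectionsAt x) ⊆
      V.diamondSectionsAt x := by
  rintro _ ⟨H, hH, rfl⟩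
  obtain ⟨⟨hHx, η, hη, hHη⟩, -⟩ := id hH
  have hη' := hVZ.integrate_sections (mem_image_of_mem _ hη)
  have heq : integrateSelection μ H x = integrateSelection μ η x := by
    simp only [integrateSelection, hHη]
  refine ⟨V.mem_sectionsAt_of_tendsto (hVZ.integrateSelection_mem_boundedSelections hH) hη' heq
    fun j => ?_, _, hη', heq⟩
  refine hVZ.tendsto_integrateSelection_sub hH (hVZ.sections_ui hη) j fun s => ?_
  -- The seminorm of `Z` indexed by a singleton is `f ↦ ν j (f s)`, so continuity in `Z` gives
  -- pointwise convergence in `s`.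
  simpa [hVZ.seminorm_eq] using Z.tendsto_seminorm_sub hHx hη hHη {(s, j)}
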